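/- Consider the degraded Gaussian model: $S^n,N^n,N_z^n$ are i.i.d. sequences with $S_i\sim\mathcal N(0,\sigma_s^2)$, $N_i\sim\mathcal N(0,\sigma_n^2)$, $N_{z,i}\sim\mathcal N(0,\sigma_{n_z}^2)$, where $\sigma_s>0$, $0<\sigma_n\le\sigma_{n_z}$ and $N_z^n=N^n+N'^n$ with $N'^n$ independent of $N^n$. An encoder that knows $S^n$ sends a (possibly randomized) input $X^n$, conditionally independent of the noises given $S^n$, with $\frac1n\sum_{i=1}^n\mathbb E X_i^2\le P$, where $P\ge0$. Bob receives $Y^n=X^n+S^n+N^n$ and Eve receives $Z^n=X^n+S^n+N_z^n$. The amplification rate is $\frac1n I(S^n;Y^n)$ and the leakage rate is $\frac1n I(S^n;Z^n)$. A pair $(R_a,R_l)$ is achieved by a sequence of encoders if, for every $\epsilon>0$ and all large $n$, $\frac1nI(S^n;Y^n)\ge R_a-\epsilon$ and $\frac1nI(S^n;Z^n)\le R_l+\epsilon$. All logarithms are to base $2$, and rates are in bits. Call $(\rho,\sigma_x)$ admissible if $-1\le\rho\le1$, $\sigma_x\ge0$ and $\sigma_x^2\le P$. The uncoded scheme with admissible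 parameters $(\rho,\sigma_x)$ sends $X_i=\rho\frac{\sigma_x}{\sigma_s}S_i+\sqrt{1-\rho^2}\,\sigma_xV_i$, with $V_i$ i.i.d. $\mathcal N(0,1)$ independent of the state and the noises. The outer-bound point of $(\rho,\sigma_x)$ is $(\bar R_a,\bar R_l)$ with $$\bar R_a(\rho,\sigma_x)=\tfrac12\log\Big(1+\frac{\sigma_s^2+\sigma_x^2+2\rho\sigma_s\sigma_x}{\sigma_n^2}\Big),\qquad \bar R_l(\rho,\sigma_x)=\tfrac12\log\Big(1+\frac{\sigma_s^2+\rho^2\sigma_x^2+2\rho\sigma_s\sigma_x}{\sigma_{n_z}^2+\sigma_x^2(1-\rho^2)}\Big),$$ and the outer-bound region is the set of all $(R_a,R_l)$ such that $R_a\le\bar R_a(\rho,\sigma_x)$ and $R_l\ge\bar R_l(\rho,\sigma_x)$ for some admissible $(\rho,\sigma_x)$. Then for all admissible $(\rho,\sigma_x)$: 1. Some uncoded scheme satisfies the power constraint and has, at every block length $n\ge1$, leakage rate exactly $\bar R_l(\rho,\sigma_x)$ and amplification rate exactly $\bar R_a(\rho,\sigma_x)-g_a$, where $g_a=\frac12\log\big(1+\frac{\sigma_x^2(1-\rho^2)}{\sigma_n^2}\big)$;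 and $g_a\le\frac12$ if $P\le\sigma_n^2$. 2. Some uncoded scheme satisfies the power constraint and has, at every block length $n\ge1$, amplification rate exactly $\bar R_a(\rho,\sigma_x)$ and leakage rate exactly $\bar R_l(\rho,\sigma_x)+g_l$, where $g_l=\frac12\log\big(1+\frac{\sigma_x^2(1-\rho^2)}{\sigma_{n_z}^2}\big)$; and $g_l\le\frac12$ if $P\le\sigma_{n_z}^2$. 3. If $\rho=\pm1$, then $g_a=g_l=0$, and some uncoded scheme has exactly the rates $\bar R_a(\rho,\sigma_x)$ and $\bar R_l(\rho,\sigma_x)$ at every block length $n\ge 1$. Consequently, for every $(R_a,R_l)$ in the outer-bound region, some uncoded scheme achieves $(R_a-\frac12,R_l)$ if $P\le\sigma_n^2$, and some uncoded scheme achieves $(R_a,R_l+\frac12)$ if $P\le\sigma_{n_z}^2$. Moreover, the points with $\rho=\pm1$ include the corner points of the outer-bound region: the largest $R_a$ in it is $\bar R_a(1,\sqrt P)$, and, if $\sigma_s\sqrt P\le\sigma_{n_z}^2+P$, the least $R_l$ in it is $\bar R_l(-1,\min\{\sqrt P,\sigma_s\})$. -/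

import Mathlib

open MeasureTheory ProbabilityTheory Filter
open scoped ENNReal

noncomputable section

/-- Mutual information, in bits, of the two coordinates under the joint law `μ`: the divergence of
`μ` from the product of its marginals. It may be infinite. -/
def mutualInfoBits {α β : Type*} [MeasurableSpace α] [MeasurableSpace β]
    (μ : Measure (α × β)) : ℝ≥0∞ :=
  InformationTheory.klDiv μ (μ.fst.prod μ.snd) / ENNReal.ofReal (Real.log 2)

/-- The law of `n` independent centred real Gaussians of variance `v`. -/
def iidGaussian (n : ℕ) (v : ℝ) : Measure (Fin n → ℝ) :=
  Measure.pi fun _ => gaussianReal 0 v.toNNReal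

/-- A (possibly randomized) encoder of block length `n`, which sees the whole state sequence `S^n`
and produces the channel input `X^n`: the conditional law of `X^n` given `S^n`. -/
abbrev Encoder (n : ℕ) := Kernel (Fin n → ℝ) (Fin n → ℝ)

/-- Parameters of the degraded Gaussian model `Y = X + S + N`, `Z = X + S + N_z`, with state
standard deviation `σs`, noise standard deviations `σn ≤ σnz`, and input power `P`. -/
structure DegradedGaussianModel where
  σs : ℝ
  σn : ℝ
  σnz : ℝ
  P : ℝ
  σs_pos : 0 < σs
  σn_pos : 0 < σn
  σn_le_σnz : σn ≤ σnz
  P_nonneg : 0 ≤ P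

namespace DegradedGaussianModel

variable (M : DegradedGaussianModel)

/-- Joint law of `(S^n, X^n)`. -/
def inputLaw {n : ℕ} (f : Encoder n) : Measure ((Fin n → ℝ) × (Fin n → ℝ)) :=
  (iidGaussian n (M.σs ^ 2)) ⊗ₘ f

/-- Joint law of `((S^n, X^n), (N^n, N'^n))`. The noises are independent of `(S^n, X^n)` and of each
other; `N'` has variance `σnz² - σn²`, and Eve's noise is `N_z = N + N'`. -/
def systemLaw {n : ℕ} (f : Encoder n) :
    Measure (((Fin n → ℝ) × (Fin n → ℝ)) × ((Fin n → ℝ) × (Fin n → ℝ))) :=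
  (M.inputLaw f).prod
    ((iidGaussian n (M.σn ^ 2)).prod (iidGaussian n (M.σnz ^ 2 - M.σn ^ 2)))

/-- Joint law of `(S^n, Y^n)`, where `Y = X + S + N`. -/
def lawSY {n : ℕ} (f : Encoder n) : Measure ((Fin n → ℝ) × (Fin n → ℝ)) :=
  (M.systemLaw f).map fun ω => (ω.1.1, ω.1.2 + ω.1.1 + ω.2.1)

/-- Joint law of `(S^n, Z^n)`, where `Z = X + S + (N + N')`. -/
def lawSZ {n : ℕ} (f : Encoder n) : Measure ((Fin n → ℝ) × (Fin n → ℝ)) :=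
  (M.systemLaw f).map fun ω => (ω.1.1, ω.1.2 + ω.1.1 + (ω.2.1 + ω.2.2))

/-- `(1/n) I(S^n; Y^n)`, in bits. -/
def ampRate {n : ℕ} (f : Encoder n) : EReal :=
  ((mutualInfoBits (M.lawSY f) / (n : ℝ≥0∞) : ℝ≥0∞) : EReal)

/-- `(1/n) I(S^n; Z^n)`, in bits. -/
def leakRate {n : ℕ} (f : Encoder n) : EReal :=
  ((mutualInfoBits (M.lawSZ f) / (n : ℝ≥0∞) : ℝ≥0∞) : EReal)

/-- The power constraint `(1/n) ∑ i, E |X i|² ≤ P`. -/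
def PowerConstraint {n : ℕ} (f : Encoder n) : Prop :=
  (∑ i, ∫⁻ ω, ENNReal.ofReal ((ω.2 i) ^ 2) ∂(M.inputLaw f)) / (n : ℝ≥0∞) ≤ ENNReal.ofReal M.P

/-- The sequence of encoders `f` achieves the amplification-leakage pair `(Ra, Rl)`. -/
def Achieves (f : ∀ n, Encoder n) (Ra Rl : ℝ) : Prop :=
  ∀ ε : ℝ, 0 < ε → ∀ᶠ n in atTop,
    IsMarkovKernel (f n) ∧ M.PowerConstraint (f n) ∧
      ((Ra - ε : ℝ) : EReal) ≤ M.ampRate (f n) ∧ M.leakRate (f n) ≤ ((Rl + ε : ℝ) : EReal)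

/-- The uncoded scheme `X i = ρ (σx / σs) S i + √(1 - ρ²) σx V i`, where the `V i` are independent
standard Gaussians independent of the state. -/
def uncoded (ρ σx : ℝ) (n : ℕ) : Encoder n :=
  (Kernel.id ×ₖ Kernel.const (Fin n → ℝ) (iidGaussian n 1)).map
    fun p i => ρ * (σx / M.σs) * p.1 i + √(1 - ρ ^ 2) * σx * p.2 i

/-- The admissible parameters: a correlation coefficient `ρ` and a standard deviation `σx` of the
channel input. -/
def Admissible (ρ σx : ℝ) : Prop :=
  -1 ≤ ρ ∧ ρ ≤ 1 ∧ 0 ≤ σx ∧ σx ^ 2 ≤ M.P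

/-- Some uncoded scheme achieves `(Ra, Rl)`. -/
def UncodedAchieves (Ra Rl : ℝ) : Prop :=
  ∃ ρ σx, M.Admissible ρ σx ∧ M.Achieves (M.uncoded ρ σx) Ra Rl

/-- Some uncoded scheme has amplification rate exactly `Ra` and leakage rate exactly `Rl`, at every
block length. -/
def UncodedAttains (Ra Rl : ℝ) : Prop :=
  ∃ ρ σx, M.Admissible ρ σx ∧ ∀ n : ℕ, 1 ≤ n →
    IsMarkovKernel (M.uncoded ρ σx n) ∧ M.PowerConstraint (M.uncoded ρ σx n) ∧
      M.ampRate (M.uncoded ρ σx n) = (Ra : EReal) ∧ M.leakRate (M.uncoded ρ σx n) = (Rl : EReal)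

/-- Outer bound on the amplification rate for the parameters `(ρ, σx)`. -/
def outerRa (ρ σx : ℝ) : ℝ :=
  1 / 2 * Real.logb 2 (1 + (M.σs ^ 2 + σx ^ 2 + 2 * ρ * M.σs * σx) / M.σn ^ 2)

/-- Outer bound on the leakage rate for the parameters `(ρ, σx)`. -/
def outerRl (ρ σx : ℝ) : ℝ :=
  1 / 2 * Real.logb 2 (1 + (M.σs ^ 2 + ρ ^ 2 * σx ^ 2 + 2 * ρ * M.σs * σx) /
    (M.σnz ^ 2 + σx ^ 2 * (1 - ρ ^ 2)))

/-- The outer-bound region. -/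
def outerRegion : Set (ℝ × ℝ) :=
  {q | ∃ ρ σx, M.Admissible ρ σx ∧ q.1 ≤ M.outerRa ρ σx ∧ M.outerRl ρ σx ≤ q.2}

/-- The gap `½ log₂ (1 + σx² (1 - ρ²) / σn²)` in the amplification rate. -/
def gapRa (ρ σx : ℝ) : ℝ :=
  1 / 2 * Real.logb 2 (1 + σx ^ 2 * (1 - ρ ^ 2) / M.σn ^ 2)

/-- The gap `½ log₂ (1 + σx² (1 - ρ²) / σnz²)` in the leakage rate. -/
def gapRl (ρ σx : ℝ) : ℝ :=
  1 / 2 * Real.logb 2 (1 + σx ^ 2 * (1 - ρ ^ 2) / M.σnz ^ 2)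

end DegradedGaussianModel

end

open MeasureTheory ProbabilityTheory Filter
open scoped ENNReal

noncomputable section

/-! Under the uncoded scheme, each receiver sees `c S + W` with `c = 1 + ρ σx / σs` and `W`
Gaussian, independent of `S`, of variance `k² + (1 - ρ²) σx²`, where `k` is that receiver's noise
deviation. `klDiv_gaussianChannelLaw` evaluates the mutual information of such a channel as `½ log
(1 + c² σs² / Var W)` per letter. For Eve this is literally `outerRl`. For Bob the chain rule
`half_logb_chain` splits the logarithm of the total power `T` of `X + S` into this rate plus
`gapRa`, which gives the first claim.

For the second claim, `Admissible.exists_sq_eq_one` finds an input with `ρ' = ±1` and the same `T`.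
Both `outerRa` and `outerRl + gapRl` depend on the parameters only through `T`, and both gaps vanish
at `ρ' = ±1`, so this input has the required rates. Each gap is at most half a bit because `σx² (1 -
ρ²) ≤ P`.

The outer region is given by formulas, so the corner points reduce to real inequalities and no
converse is needed. -/

theorem MeasureTheory.Measure.pi_withDensity {ι : Type*} [Fintype ι] {X : ι → Type*}
    [∀ i, MeasurableSpace (X i)] (μ : ∀ i, Measure (X i)) [∀ i, IsProbabilityMeasure (μ i)]
    {f : ∀ i, X i → ℝ≥0∞} (hf : ∀ i, Measurable (f i))
    [∀ i, SigmaFinite ((μ i).withDensity (f i))] :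
    Measure.pi (fun i => (μ i).withDensity (f i)) =
      (Measure.pi μ).withDensity fun x => ∏ i, f i (x i) := by
  refine Measure.pi_eq fun s hs => ?_
  rw [withDensity_apply _ (MeasurableSet.univ_pi hs), ← lintegral_indicator (.univ_pi hs)]
  have hm : ∀ i, Measurable ((s i).indicator (f i)) := fun i => (hf i).indicator (hs i)
  have hprod : ∀ x : ∀ i, X i, (Set.univ.pi s).indicator (fun x => ∏ i, f i (x i)) x =
      ∏ i, (s i).indicator (f i) (x i) := by
    intro x
    by_cases hx : x ∈ Set.univ.pi s
    · rw [Set.indicator_of_mem hx]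
      exact Finset.prod_congr rfl fun i _ => (Set.indicator_of_mem (hx i trivial) _).symm
    · rw [Set.indicator_of_notMem hx]
      obtain ⟨i, hi⟩ : ∃ i, x i ∉ s i := by simpa [Set.mem_pi] using hx
      exact (Finset.prod_eq_zero (Finset.mem_univ i) (Set.indicator_of_notMem hi _)).symm
  simp_rw [hprod]
  -- Coordinates are independent under a product of probability measures, so the integral over a box
  -- factors.
  rw [lintegral_prod_eq_prod_lintegral_of_indepFun Finset.univ
    (fun i (x : ∀ i, X i) => (s i).indicator (f i) (x i))
    (iIndepFun_pi fun i => (hm i).aemeasurable) fun i => (hm i).comp (measurable_pi_apply i)]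
  refine Finset.prod_congr rfl fun i _ => ?_
  rw [(measurePreserving_eval μ i).lintegral_comp (hm i), lintegral_indicator (hs i),
    withDensity_apply _ (hs i)]

/-- The logarithm of the density of `gaussianReal m w` with respect to `gaussianReal 0 t`. -/
def gaussianLogRatio (w t m y : ℝ) : ℝ :=
  1 / 2 * Real.log (t / w) - (y - m) ^ 2 / (2 * w) + y ^ 2 / (2 * t)

theorem gaussianReal_eq_withDensity_gaussianReal {w t : ℝ} (hw : 0 < w) (ht : 0 < t) (m : ℝ) :
    gaussianReal m w.toNNReal = (gaussianReal 0 t.toNNReal).withDensity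
      fun y => ENNReal.ofReal (Real.exp (gaussianLogRatio w t m y)) := by
  have hw' : w.toNNReal ≠ 0 := by simpa using hw
  have ht' : t.toNNReal ≠ 0 := by simpa using ht
  rw [gaussianReal_of_var_ne_zero _ hw', gaussianReal_of_var_ne_zero _ ht', ← withDensity_mul _
    (measurable_gaussianPDF _ _) (by unfold gaussianLogRatio; fun_prop)]
  congr 1
  ext1 y
  rw [Pi.mul_apply, gaussianPDF, gaussianPDF,
    ← ENNReal.ofReal_mul (gaussianPDFReal_nonneg _ _ _)]
  congr 1
  -- The constant term of the exponent is the ratio of the two normalizing factors.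
  have hsq : Real.exp (1 / 2 * Real.log (t / w)) = √t / √w := by
    rw [← Real.sqrt_div ht.le, Real.sqrt_eq_rpow, Real.rpow_def_of_pos (div_pos ht hw), mul_comm]
  rw [gaussianPDFReal, gaussianPDFReal, gaussianLogRatio,
    Real.coe_toNNReal _ hw.le, Real.coe_toNNReal _ ht.le]
  rw [show 1 / 2 * Real.log (t / w) - (y - m) ^ 2 / (2 * w) + y ^ 2 / (2 * t) =
    1 / 2 * Real.log (t / w) + (y ^ 2 / (2 * t) + -(y - m) ^ 2 / (2 * w)) by ring, Real.exp_add,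
    Real.exp_add, hsq, sub_zero, neg_div (2 * t) (y ^ 2), Real.exp_neg,
    Real.sqrt_mul (by positivity) w, Real.sqrt_mul (by positivity) t]
  have h1 : 0 < √w := Real.sqrt_pos.2 hw
  have h2 : 0 < √t := Real.sqrt_pos.2 ht
  have h3 := Real.exp_pos (y ^ 2 / (2 * t))
  field_simp

instance isProbabilityMeasure_iidGaussian (n : ℕ) (v : ℝ) :
    IsProbabilityMeasure (iidGaussian n v) := by
  unfold iidGaussian; infer_instance

/-! ### Linear images, translates and densities of i.i.d. Gaussian vectors -/

theorem map_prod_gaussianReal_linear (a b : ℝ) {u v : ℝ} (hu : 0 ≤ u) (hv : 0 ≤ v) :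
    ((gaussianReal 0 u.toNNReal).prod (gaussianReal 0 v.toNNReal)).map
      (fun p => a * p.1 + b * p.2) = gaussianReal 0 (a ^ 2 * u + b ^ 2 * v).toNNReal := by
  have : (fun p : ℝ × ℝ => a * p.1 + b * p.2) =
      (fun p : ℝ × ℝ => p.1 + p.2) ∘ Prod.map (a * ·) (b * ·) := rfl
  rw [this, ← Measure.map_map (by fun_prop) (by fun_prop),
    ← Measure.map_prod_map _ _ (by fun_prop) (by fun_prop), gaussianReal_map_const_mul,
    gaussianReal_map_const_mul, mul_zero, mul_zero]
  change Measure.conv _ _ = _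
  rw [gaussianReal_conv_gaussianReal, add_zero]
  congr 1
  ext
  simp [hu, hv, show 0 ≤ a ^ 2 * u + b ^ 2 * v by positivity]

theorem map_prod_iidGaussian_linear (n : ℕ) (a b : ℝ) {u v : ℝ} (hu : 0 ≤ u) (hv : 0 ≤ v) :
    ((iidGaussian n u).prod (iidGaussian n v)).map
      (fun p i => a * p.1 i + b * p.2 i) = iidGaussian n (a ^ 2 * u + b ^ 2 * v) := by
  unfold iidGaussian
  rw [← (measurePreserving_arrowProdEquivProdArrow ℝ ℝ (Fin n) _ _).map_eq,
    Measure.map_map (by fun_prop) (MeasurableEquiv.measurable _)]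
  have h : Measurable fun p : ℝ × ℝ => a * p.1 + b * p.2 := by fun_prop
  rw [← map_prod_gaussianReal_linear a b hu hv]
  have := Measure.isProbabilityMeasure_map (μ := (gaussianReal 0 u.toNNReal).prod
    (gaussianReal 0 v.toNNReal)) h.aemeasurable
  exact Measure.pi_map_pi (ι := Fin n) (μ := fun _ => (gaussianReal 0 u.toNNReal).prod
    (gaussianReal 0 v.toNNReal)) (f := fun _ p => a * p.1 + b * p.2) fun i => h.aemeasurable

theorem map_add_iidGaussian (n : ℕ) {w : ℝ} (m : Fin n → ℝ) :
    (iidGaussian n w).map (fun x i => m i + x i) =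
      Measure.pi fun i => gaussianReal (m i) w.toNNReal := by
  unfold iidGaussian
  have h : ∀ i : Fin n, (gaussianReal 0 w.toNNReal).map (m i + ·) =
      gaussianReal (m i) w.toNNReal := fun i => by
    rw [gaussianReal_map_const_add, zero_add]
  have : ∀ i : Fin n, SigmaFinite ((gaussianReal 0 w.toNNReal).map (m i + ·)) := fun i => by
    rw [h]; infer_instance
  rw [Measure.pi_map_pi (ι := Fin n) (μ := fun _ => gaussianReal 0 w.toNNReal)
    (f := fun i x => m i + x) fun i => by fun_prop]
  simp_rw [h]

theorem pi_gaussianReal_eq_withDensity (n : ℕ) {w t : ℝ} (hw : 0 < w) (ht : 0 < t)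
    (m : Fin n → ℝ) :
    Measure.pi (fun i => gaussianReal (m i) w.toNNReal) = (iidGaussian n t).withDensity
      fun y => ENNReal.ofReal (Real.exp (∑ i, gaussianLogRatio w t (m i) (y i))) := by
  have h := fun i : Fin n => gaussianReal_eq_withDensity_gaussianReal hw ht (m i)
  have : ∀ i : Fin n, SigmaFinite ((gaussianReal 0 t.toNNReal).withDensity
      fun y => ENNReal.ofReal (Real.exp (gaussianLogRatio w t (m i) y))) := fun i => by
    rw [← h]; infer_instance
  simp_rw [h]
  rw [Measure.pi_withDensity _ fun i => by unfold gaussianLogRatio; fun_prop]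
  simp_rw [Real.exp_sum, ENNReal.ofReal_prod_of_nonneg fun i _ => (Real.exp_pos _).le]
  rfl

/-! ### Mutual information of the Gaussian channel -/

/-- Joint law of `(S, c S + W)`, where `S` and `W` are independent vectors of `n` independent
Gaussians of variances `v` and `w`. -/
def gaussianChannelLaw (n : ℕ) (v w c : ℝ) : Measure ((Fin n → ℝ) × (Fin n → ℝ)) :=
  ((iidGaussian n v).prod (iidGaussian n w)).map fun p => (p.1, fun i => c * p.1 i + p.2 i)

instance isProbabilityMeasure_gaussianChannelLaw (n : ℕ) (v w c : ℝ) :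
    IsProbabilityMeasure (gaussianChannelLaw n v w c) :=
  Measure.isProbabilityMeasure_map (by fun_prop)

theorem fst_gaussianChannelLaw (n : ℕ) (v w c : ℝ) :
    (gaussianChannelLaw n v w c).fst = iidGaussian n v := by
  rw [gaussianChannelLaw, Measure.fst, Measure.map_map (by fun_prop) (by fun_prop)]
  exact Measure.fst_prod

theorem snd_gaussianChannelLaw (n : ℕ) {v w : ℝ} (c : ℝ) (hv : 0 ≤ v) (hw : 0 ≤ w) :
    (gaussianChannelLaw n v w c).snd = iidGaussian n (c ^ 2 * v + w) := by
  rw [gaussianChannelLaw, Measure.snd, Measure.map_map (by fun_prop) (by fun_prop)]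
  simpa [Function.comp_def] using map_prod_iidGaussian_linear n c 1 hv hw

/-- Given `S = s`, the output is a product of Gaussians centred at `c s i`, whose density against
the reference vector is known. When `t` is the output variance, the reference measure is the product
of the marginals. -/
theorem gaussianChannelLaw_eq_withDensity (n : ℕ) {v w t : ℝ} (c : ℝ) (hw : 0 < w) (ht : 0 < t) :
    gaussianChannelLaw n v w c = ((iidGaussian n v).prod (iidGaussian n t)).withDensity
      fun p => ENNReal.ofReal (Real.exp (∑ i, gaussianLogRatio w t (c * p.1 i) (p.2 i))) := by
  refine Measure.ext_of_lintegral _ fun f hf => ?_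
  have hd : Measurable fun p : (Fin n → ℝ) × (Fin n → ℝ) =>
      ENNReal.ofReal (Real.exp (∑ i, gaussianLogRatio w t (c * p.1 i) (p.2 i))) := by
    unfold gaussianLogRatio; fun_prop
  rw [gaussianChannelLaw, lintegral_map hf (by fun_prop), lintegral_prod _ (by fun_prop),
    lintegral_withDensity_eq_lintegral_mul _ hd hf, lintegral_prod _ (by fun_prop)]
  refine lintegral_congr fun s => ?_
  have hg : Measurable fun y => f (s, y) := hf.comp measurable_prodMk_left
  refine (lintegral_map (μ := iidGaussian n w) (g := fun x i => c * s i + x i) hg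
    (by fun_prop)).symm.trans ?_
  rw [map_add_iidGaussian n fun i => c * s i, pi_gaussianReal_eq_withDensity n hw ht]
  exact lintegral_withDensity_eq_lintegral_mul _ (hd.comp measurable_prodMk_left) hg

theorem integrable_sq_gaussianReal (v : NNReal) :
    Integrable (fun x : ℝ => x ^ 2) (gaussianReal 0 v) := by
  simpa using (memLp_id_gaussianReal (μ := 0) (v := v) 2).integrable_sq

theorem integral_sq_gaussianReal (v : NNReal) : ∫ x, x ^ 2 ∂gaussianReal 0 v = v := by
  have h := variance_fun_id_gaussianReal (μ := 0) (v := v)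
  rwa [variance_of_integral_eq_zero (by fun_prop) (by simp [integral_id_gaussianReal])] at h

theorem integrable_sq_iidGaussian (n : ℕ) (v : ℝ) (i : Fin n) :
    Integrable (fun x : Fin n → ℝ => x i ^ 2) (iidGaussian n v) :=
  integrable_comp_eval (X := fun _ : Fin n => ℝ) (f := fun x : ℝ => x ^ 2)
    (integrable_sq_gaussianReal _)

theorem integral_sq_iidGaussian (n : ℕ) {v : ℝ} (hv : 0 ≤ v) (i : Fin n) :
    ∫ x, x i ^ 2 ∂iidGaussian n v = v := by
  rw [iidGaussian, integral_comp_eval (X := fun _ : Fin n => ℝ) (f := fun x : ℝ => x ^ 2) (by fun_prop),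
    integral_sq_gaussianReal, Real.coe_toNNReal _ hv]

/-- The log-likelihood ratio is a sum of quadratics. Under the joint law, `(y - c s)²` has mean `w`
and `y²` has mean `t`, so the quadratic terms contribute `-1/2 + 1/2` per coordinate and only `½ log
(t / w)` survives. -/
theorem klDiv_gaussianChannelLaw (n : ℕ) {v w : ℝ} (c : ℝ) (hv : 0 ≤ v) (hw : 0 < w) :
    InformationTheory.klDiv (gaussianChannelLaw n v w c)
      ((gaussianChannelLaw n v w c).fst.prod (gaussianChannelLaw n v w c).snd) =
    ENNReal.ofReal (n * (1 / 2 * Real.log (1 + c ^ 2 * v / w))) := by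
  set t := c ^ 2 * v + w with ht_def
  have ht : 0 < t := by positivity
  rw [fst_gaussianChannelLaw, snd_gaussianChannelLaw n c hv hw.le, ← ht_def]
  set μ := gaussianChannelLaw n v w c with hμ
  set ν := (iidGaussian n v).prod (iidGaussian n t) with hν
  have hd := gaussianChannelLaw_eq_withDensity n (v := v) c hw ht
  rw [← hμ, ← hν] at hd
  have hac : μ ≪ ν := hd ▸ withDensity_absolutelyContinuous _ _
  have hllr : llr μ ν =ᵐ[μ] fun p => ∑ i, gaussianLogRatio w t (c * p.1 i) (p.2 i) := by
    have h := Measure.rnDeriv_withDensity ν (f := fun p : (Fin n → ℝ) × (Fin n → ℝ) =>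
      ENNReal.ofReal (Real.exp (∑ i, gaussianLogRatio w t (c * p.1 i) (p.2 i))))
      (by unfold gaussianLogRatio; fun_prop)
    rw [← hd] at h
    filter_upwards [hac.ae_le h] with p hp
    rw [llr, hp, ENNReal.toReal_ofReal (Real.exp_pos _).le, Real.log_exp]
  -- The residual is the noise `W` itself; the next moment is read off the output marginal.
  have hI1 : ∀ i, Integrable (fun p : (Fin n → ℝ) × (Fin n → ℝ) => (p.2 i - c * p.1 i) ^ 2) μ ∧
      ∫ p, (p.2 i - c * p.1 i) ^ 2 ∂μ = w := by
    intro i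
    rw [hμ, gaussianChannelLaw, integrable_map_measure (by fun_prop) (by fun_prop),
      integral_map (by fun_prop) (by fun_prop)]
    simp only [Function.comp_def, add_sub_cancel_left]
    refine ⟨(integrable_sq_iidGaussian n w i).comp_snd _, ?_⟩
    rw [integral_fun_snd (fun x : Fin n → ℝ => x i ^ 2), integral_sq_iidGaussian n hw.le]
    simp
  have hI2 : ∀ i, Integrable (fun p : (Fin n → ℝ) × (Fin n → ℝ) => p.2 i ^ 2) μ ∧
      ∫ p, p.2 i ^ 2 ∂μ = t := by
    intro i
    have hs := snd_gaussianChannelLaw n c hv hw.le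
    rw [← hμ, ← ht_def] at hs
    have h1 := integrable_sq_iidGaussian n t i
    have h2 := integral_sq_iidGaussian n ht.le i
    rw [← hs, Measure.snd] at h1 h2
    have hm : Measurable fun x : Fin n → ℝ => x i ^ 2 := by fun_prop
    rw [integrable_map_measure hm.aestronglyMeasurable (by fun_prop)] at h1
    rw [integral_map (by fun_prop) hm.aestronglyMeasurable] at h2
    exact ⟨h1, h2⟩
  have hint : ∀ i, Integrable (fun p : (Fin n → ℝ) × (Fin n → ℝ) =>
      gaussianLogRatio w t (c * p.1 i) (p.2 i)) μ := fun i =>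
    ((integrable_const _).sub ((hI1 i).1.div_const _)).add ((hI2 i).1.div_const _)
  have hval : ∀ i, ∫ p, gaussianLogRatio w t (c * p.1 i) (p.2 i) ∂μ =
      1 / 2 * Real.log (1 + c ^ 2 * v / w) := by
    intro i
    unfold gaussianLogRatio
    rw [integral_add (f := fun p => 1 / 2 * Real.log (t / w) - (p.2 i - c * p.1 i) ^ 2 / (2 * w))
      ((integrable_const _).sub ((hI1 i).1.div_const _)) ((hI2 i).1.div_const _),
      integral_sub (integrable_const _) ((hI1 i).1.div_const _), integral_div, integral_div,
      (hI1 i).2, (hI2 i).2, integral_const, probReal_univ, one_smul,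
      show t / w = 1 + c ^ 2 * v / w by rw [ht_def]; field_simp; ring]
    field_simp
    ring
  rw [InformationTheory.klDiv_of_ac_of_integrable hac
    ((integrable_congr hllr).2 (integrable_finsetSum _ fun i _ => hint i)),
    integral_congr_ae hllr, integral_finsetSum _ fun i _ => hint i]
  simp [hval]

theorem mutualInfoBits_gaussianChannelLaw_div {n : ℕ} (hn : 1 ≤ n) {v w : ℝ} (c : ℝ) (hv : 0 ≤ v)
    (hw : 0 < w) :
    mutualInfoBits (gaussianChannelLaw n v w c) / (n : ℝ≥0∞) =
      ENNReal.ofReal (1 / 2 * Real.logb 2 (1 + c ^ 2 * v / w)) := by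
  have hn' : (0 : ℝ) < n := by exact_mod_cast hn
  have h2 : 0 < Real.log 2 := Real.log_pos one_lt_two
  rw [mutualInfoBits, klDiv_gaussianChannelLaw n c hv hw, ← ENNReal.ofReal_div_of_pos h2,
    ← ENNReal.ofReal_natCast n, ← ENNReal.ofReal_div_of_pos hn', Real.logb]
  congr 1
  field_simp

namespace DegradedGaussianModel

variable (M : DegradedGaussianModel)

/-! ### The uncoded scheme as a Gaussian channel -/

theorem isMarkovKernel_uncoded (ρ σx : ℝ) (n : ℕ) : IsMarkovKernel (M.uncoded ρ σx n) :=
  Kernel.IsMarkovKernel.map _ (by fun_prop)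

theorem inputLaw_uncoded (ρ σx : ℝ) (n : ℕ) :
    M.inputLaw (M.uncoded ρ σx n) =
      ((iidGaussian n (M.σs ^ 2)).prod (iidGaussian n 1)).map
        fun p => (p.1, fun i => ρ * (σx / M.σs) * p.1 i + √(1 - ρ ^ 2) * σx * p.2 i) := by
  have := M.isMarkovKernel_uncoded ρ σx n
  ext E hE
  rw [inputLaw, Measure.compProd_apply hE, Measure.map_apply (by fun_prop) hE,
    Measure.prod_apply (hE.preimage (by fun_prop))]
  refine lintegral_congr fun s => ?_
  rw [uncoded, Kernel.map_apply' _ (by fun_prop) _ (measurable_prodMk_left hE), Kernel.prod_apply,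
    Kernel.id_apply, Kernel.const_apply, Measure.dirac_prod,
    Measure.map_apply (by fun_prop)
      ((measurable_prodMk_left hE).preimage (by fun_prop))]
  rfl

/-- Joint law of `(S, X + S + N)`, where the noise `N` has law `K`. -/
def outputLaw {n : ℕ} (f : Encoder n) (K : Measure (Fin n → ℝ)) :
    Measure ((Fin n → ℝ) × (Fin n → ℝ)) :=
  ((M.inputLaw f).prod K).map fun ω => (ω.1.1, ω.1.2 + ω.1.1 + ω.2)

/-- Only the law of the effective noise matters, so Bob and Eve can be treated alike. -/
theorem map_systemLaw {n : ℕ} (f : Encoder n) [IsMarkovKernel f]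
    {φ : (Fin n → ℝ) × (Fin n → ℝ) → (Fin n → ℝ)} (hφ : Measurable φ) :
    ((M.systemLaw f).map fun ω => (ω.1.1, ω.1.2 + ω.1.1 + φ ω.2)) =
      M.outputLaw f (((iidGaussian n (M.σn ^ 2)).prod
        (iidGaussian n (M.σnz ^ 2 - M.σn ^ 2))).map φ) := by
  have : IsProbabilityMeasure (M.inputLaw f) := by unfold inputLaw; infer_instance
  rw [outputLaw]
  nth_rw 1 [← Measure.map_id (μ := M.inputLaw f)]
  rw [Measure.map_prod_map _ _ measurable_id hφ, Measure.map_map (by fun_prop) (by fun_prop)]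
  rfl

theorem lawSY_eq_outputLaw {n : ℕ} (f : Encoder n) [IsMarkovKernel f] :
    M.lawSY f = M.outputLaw f (iidGaussian n (M.σn ^ 2)) := by
  rw [lawSY, M.map_systemLaw f measurable_fst]
  exact congrArg _ Measure.fst_prod

/-- The variances of `N` and `N'` add up to `σnz²`; `σn ≤ σnz` makes the second one nonnegative. -/
theorem lawSZ_eq_outputLaw {n : ℕ} (f : Encoder n) [IsMarkovKernel f] :
    M.lawSZ f = M.outputLaw f (iidGaussian n (M.σnz ^ 2)) := by
  have h := map_prod_iidGaussian_linear n 1 1 (sq_nonneg M.σn)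
    (sub_nonneg.2 (pow_le_pow_left₀ M.σn_pos.le M.σn_le_σnz 2))
  rw [lawSZ, M.map_systemLaw f (φ := fun p => p.1 + p.2) (by fun_prop)]
  simp only [one_mul, one_pow, add_sub_cancel] at h
  rw [← h]
  rfl

/-- The part of `X` proportional to `S` joins the state, and the fresh randomness `V` joins the
channel noise. -/
theorem outputLaw_uncoded (ρ σx : ℝ) (n : ℕ) {k : ℝ} (hk : 0 ≤ k) :
    M.outputLaw (M.uncoded ρ σx n) (iidGaussian n k) =
      gaussianChannelLaw n (M.σs ^ 2) ((√(1 - ρ ^ 2) * σx) ^ 2 + k) (ρ * (σx / M.σs) + 1) := by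
  have hw : iidGaussian n ((√(1 - ρ ^ 2) * σx) ^ 2 + k) = ((iidGaussian n 1).prod
      (iidGaussian n k)).map fun p i => √(1 - ρ ^ 2) * σx * p.1 i + 1 * p.2 i := by
    rw [map_prod_iidGaussian_linear n _ _ zero_le_one hk]
    congr 1
    ring
  rw [gaussianChannelLaw, hw, outputLaw, inputLaw_uncoded]
  nth_rw 1 [← Measure.map_id (μ := iidGaussian n k)]
  nth_rw 2 [← Measure.map_id (μ := iidGaussian n (M.σs ^ 2))]
  rw [Measure.map_prod_map _ _ (by fun_prop) measurable_id,
    Measure.map_prod_map _ _ measurable_id (by fun_prop), ← Measure.prodAssoc_prod,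
    Measure.map_map (by fun_prop) (by fun_prop), Measure.map_map (by fun_prop) (by fun_prop),
    Measure.map_map (by fun_prop) (by fun_prop)]
  congr 1
  ext1 p
  refine Prod.ext rfl (funext fun i => ?_)
  simp [MeasurableEquiv.prodAssoc]
  ring

/-- The rate, in bits per channel use, of the uncoded scheme at noise standard deviation `k`. -/
def uncodedRate (ρ σx k : ℝ) : ℝ :=
  1 / 2 * Real.logb 2 (1 + (M.σs ^ 2 + ρ ^ 2 * σx ^ 2 + 2 * ρ * M.σs * σx) /
    (k ^ 2 + σx ^ 2 * (1 - ρ ^ 2)))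

variable {M}

theorem Admissible.one_sub_sq_nonneg {ρ σx : ℝ} (h : M.Admissible ρ σx) : 0 ≤ 1 - ρ ^ 2 := by
  nlinarith [h.1, h.2.1]

theorem uncodedRate_nonneg {ρ σx : ℝ} (h : M.Admissible ρ σx) (k : ℝ) :
    0 ≤ M.uncodedRate ρ σx k := by
  have := h.one_sub_sq_nonneg
  rw [uncodedRate, show M.σs ^ 2 + ρ ^ 2 * σx ^ 2 + 2 * ρ * M.σs * σx = (M.σs + ρ * σx) ^ 2 by ring]
  have : 0 ≤ (M.σs + ρ * σx) ^ 2 / (k ^ 2 + σx ^ 2 * (1 - ρ ^ 2)) := by positivity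
  have := Real.logb_nonneg one_lt_two (le_add_of_nonneg_right this)
  positivity

theorem rate_outputLaw_uncoded {ρ σx : ℝ} (h : M.Admissible ρ σx) {n : ℕ} (hn : 1 ≤ n) {k : ℝ}
    (hk : 0 < k) :
    ((mutualInfoBits (M.outputLaw (M.uncoded ρ σx n) (iidGaussian n (k ^ 2))) / (n : ℝ≥0∞) :
      ℝ≥0∞) : EReal) = (M.uncodedRate ρ σx k : EReal) := by
  have hs := M.σs_pos
  rw [M.outputLaw_uncoded ρ σx n (sq_nonneg k),
    mutualInfoBits_gaussianChannelLaw_div hn _ (sq_nonneg _) (by positivity), mul_pow,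
    Real.sq_sqrt h.one_sub_sq_nonneg, ← mul_pow, EReal.coe_ennreal_ofReal,
    show ((ρ * (σx / M.σs) + 1) * M.σs) ^ 2 =
      M.σs ^ 2 + ρ ^ 2 * σx ^ 2 + 2 * ρ * M.σs * σx by field_simp; ring,
    mul_comm (1 - ρ ^ 2), add_comm _ (k ^ 2)]
  -- Coercing `ENNReal.ofReal` to `EReal` yields a maximum with `0`, which nonnegativity of the rate
  -- removes.
  exact congrArg _ (max_eq_left (uncodedRate_nonneg h k))

theorem ampRate_uncoded {ρ σx : ℝ} (h : M.Admissible ρ σx) {n : ℕ} (hn : 1 ≤ n) :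
    M.ampRate (M.uncoded ρ σx n) = (M.uncodedRate ρ σx M.σn : EReal) := by
  have := M.isMarkovKernel_uncoded ρ σx n
  rw [ampRate, lawSY_eq_outputLaw]
  exact rate_outputLaw_uncoded h hn M.σn_pos

theorem leakRate_uncoded {ρ σx : ℝ} (h : M.Admissible ρ σx) {n : ℕ} (hn : 1 ≤ n) :
    M.leakRate (M.uncoded ρ σx n) = (M.outerRl ρ σx : EReal) := by
  have := M.isMarkovKernel_uncoded ρ σx n
  rw [leakRate, lawSZ_eq_outputLaw]
  -- `outerRl` unfolds to `uncodedRate` at `σnz`.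
  exact rate_outputLaw_uncoded h hn (M.σn_pos.trans_le M.σn_le_σnz)

/-- Each input letter has variance `ρ² σx² + (1 - ρ²) σx² = σx²`. -/
theorem powerConstraint_uncoded {ρ σx : ℝ} (h : M.Admissible ρ σx) {n : ℕ} (hn : 1 ≤ n) :
    M.PowerConstraint (M.uncoded ρ σx n) := by
  have hs := M.σs_pos
  have hn' : (n : ℝ≥0∞) ≠ 0 := by exact_mod_cast (Nat.one_le_iff_ne_zero.1 hn)
  have hlaw : (M.inputLaw (M.uncoded ρ σx n)).map Prod.snd = iidGaussian n (σx ^ 2) := by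
    rw [inputLaw_uncoded, Measure.map_map (by fun_prop) (by fun_prop)]
    refine (map_prod_iidGaussian_linear n (ρ * (σx / M.σs)) (√(1 - ρ ^ 2) * σx)
      (sq_nonneg M.σs) zero_le_one).trans ?_
    congr 1
    rw [mul_pow (√_), Real.sq_sqrt h.one_sub_sq_nonneg]
    field_simp
    ring
  have hi : ∀ i : Fin n, ∫⁻ ω, ENNReal.ofReal ((ω.2 i) ^ 2) ∂M.inputLaw (M.uncoded ρ σx n) =
      ENNReal.ofReal (σx ^ 2) := by
    intro i
    rw [← lintegral_map (f := fun x : Fin n → ℝ => ENNReal.ofReal (x i ^ 2)) (g := Prod.snd)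
      (by fun_prop) measurable_snd, hlaw,
      ← ofReal_integral_eq_lintegral_ofReal (integrable_sq_iidGaussian n _ i)
        (ae_of_all _ fun _ => sq_nonneg _), integral_sq_iidGaussian n (sq_nonneg _)]
  rw [PowerConstraint]
  simp_rw [hi]
  rw [Finset.sum_const, Finset.card_univ, Fintype.card_fin, nsmul_eq_mul,
    mul_comm, ENNReal.mul_div_cancel_right hn' (ENNReal.natCast_ne_top n)]
  exact ENNReal.ofReal_le_ofReal h.2.2.2

theorem Admissible.uncodedAttains {ρ σx : ℝ} (h : M.Admissible ρ σx) :
    M.UncodedAttains (M.uncodedRate ρ σx M.σn) (M.outerRl ρ σx) :=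
  ⟨ρ, σx, h, fun n hn => ⟨M.isMarkovKernel_uncoded ρ σx n, powerConstraint_uncoded h hn,
    ampRate_uncoded h hn, leakRate_uncoded h hn⟩⟩

theorem UncodedAttains.uncodedAchieves {a l Ra Rl : ℝ} (h : M.UncodedAttains a l) (ha : Ra ≤ a)
    (hl : l ≤ Rl) : M.UncodedAchieves Ra Rl := by
  obtain ⟨ρ, σx, hadm, h⟩ := h
  refine ⟨ρ, σx, hadm, fun ε hε => ?_⟩
  filter_upwards [eventually_ge_atTop 1] with n hn
  obtain ⟨h1, h2, h3, h4⟩ := h n hn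
  refine ⟨h1, h2, ?_, ?_⟩
  · rw [h3, EReal.coe_le_coe_iff]; linarith
  · rw [h4, EReal.coe_le_coe_iff]; linarith

/-! ### Gaps to the outer bound -/

/-- The chain rule `½ log (1 + (x + y) / k) = ½ log (1 + x / (k + y)) + ½ log (1 + y / k)`. -/
theorem half_logb_chain {x y k : ℝ} (hx : 0 ≤ x) (hy : 0 ≤ y) (hk : 0 < k) :
    1 / 2 * Real.logb 2 (1 + (x + y) / k) =
      1 / 2 * Real.logb 2 (1 + x / (k + y)) + 1 / 2 * Real.logb 2 (1 + y / k) := by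
  rw [← mul_add, ← Real.logb_mul (by positivity) (by positivity)]
  congr 2
  field_simp
  ring

/-- The chain rule with `x = (σs + ρ σx)²`, the power carrying the state, and `y = σx² (1 - ρ²)`,
the power of the fresh randomness. -/
theorem uncodedRate_add_gap {ρ σx : ℝ} (h : M.Admissible ρ σx) {k : ℝ} (hk : 0 < k) :
    M.uncodedRate ρ σx k + 1 / 2 * Real.logb 2 (1 + σx ^ 2 * (1 - ρ ^ 2) / k ^ 2) =
      1 / 2 * Real.logb 2 (1 + (M.σs ^ 2 + σx ^ 2 + 2 * ρ * M.σs * σx) / k ^ 2) := by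
  have h1 := h.one_sub_sq_nonneg
  rw [uncodedRate, ← half_logb_chain (by nlinarith [sq_nonneg (M.σs + ρ * σx)]) (by positivity)
    (by positivity)]
  congr 4
  ring

theorem uncodedRate_σn {ρ σx : ℝ} (h : M.Admissible ρ σx) :
    M.uncodedRate ρ σx M.σn = M.outerRa ρ σx - M.gapRa ρ σx :=
  eq_sub_of_add_eq (uncodedRate_add_gap h M.σn_pos)

theorem outerRl_add_gapRl {ρ σx : ℝ} (h : M.Admissible ρ σx) :
    M.outerRl ρ σx + M.gapRl ρ σx =
      1 / 2 * Real.logb 2 (1 + (M.σs ^ 2 + σx ^ 2 + 2 * ρ * M.σs * σx) / M.σnz ^ 2) :=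
  uncodedRate_add_gap h (M.σn_pos.trans_le M.σn_le_σnz)

/-- A fully correlated or fully anticorrelated input produces every attainable power of `X + S`. -/
theorem Admissible.exists_sq_eq_one {ρ σx : ℝ} (h : M.Admissible ρ σx) :
    ∃ ρ' σx', M.Admissible ρ' σx' ∧ ρ' ^ 2 = 1 ∧
      M.σs ^ 2 + σx' ^ 2 + 2 * ρ' * M.σs * σx' = M.σs ^ 2 + σx ^ 2 + 2 * ρ * M.σs * σx := by
  obtain ⟨h1, h2, h3, h4⟩ := h
  have hs := M.σs_pos
  have hsx : 0 ≤ M.σs * σx := by positivity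
  set T := M.σs ^ 2 + σx ^ 2 + 2 * ρ * M.σs * σx with hT
  -- Since `|ρ| ≤ 1`, `√T` lies between `σs - σx` and `σs + σx`. Hence `|√T - σs| ≤ σx` is an
  -- affordable amplitude, and the sign of `√T - σs` dictates `ρ'`.
  have hlow : (M.σs - σx) ^ 2 ≤ T := by nlinarith
  have hT0 : 0 ≤ T := (sq_nonneg _).trans hlow
  have hup : √T ≤ M.σs + σx := Real.sqrt_le_iff.2 ⟨by positivity, by nlinarith⟩
  have hlo : M.σs - σx ≤ √T := Real.le_sqrt_of_sq_le hlow
  have hpow : |√T - M.σs| ≤ σx := abs_le.2 ⟨by linarith, by linarith⟩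
  have hP : |√T - M.σs| ^ 2 ≤ M.P := (pow_le_pow_left₀ (abs_nonneg _) hpow 2).trans h4
  have hsq := Real.sq_sqrt hT0
  rcases abs_choice (√T - M.σs) with ha | ha
  · refine ⟨1, |√T - M.σs|, ⟨by norm_num, le_rfl, abs_nonneg _, hP⟩, by norm_num, ?_⟩
    rw [ha]; linear_combination hsq
  · refine ⟨-1, |√T - M.σs|, ⟨le_rfl, by norm_num, abs_nonneg _, hP⟩, by norm_num, ?_⟩
    rw [ha]; linear_combination hsq

theorem gapRa_eq_zero {ρ : ℝ} (hρ : ρ ^ 2 = 1) (σx : ℝ) : M.gapRa ρ σx = 0 := by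
  simp [gapRa, hρ]

theorem gapRl_eq_zero {ρ : ℝ} (hρ : ρ ^ 2 = 1) (σx : ℝ) : M.gapRl ρ σx = 0 := by
  simp [gapRl, hρ]

theorem Admissible.uncodedAttains_outerRa_sub_gapRa {ρ σx : ℝ} (h : M.Admissible ρ σx) :
    M.UncodedAttains (M.outerRa ρ σx - M.gapRa ρ σx) (M.outerRl ρ σx) :=
  uncodedRate_σn h ▸ h.uncodedAttains

theorem Admissible.uncodedAttains_outerRl_add_gapRl {ρ σx : ℝ} (h : M.Admissible ρ σx) :
    M.UncodedAttains (M.outerRa ρ σx) (M.outerRl ρ σx + M.gapRl ρ σx) := by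
  obtain ⟨ρ', σx', h', hρ', hT⟩ := h.exists_sq_eq_one
  have ha : M.outerRa ρ σx = M.outerRa ρ' σx' - M.gapRa ρ' σx' := by
    rw [gapRa_eq_zero hρ', sub_zero, outerRa, outerRa, hT]
  have hl : M.outerRl ρ σx + M.gapRl ρ σx = M.outerRl ρ' σx' := by
    rw [← add_zero (M.outerRl ρ' σx'), ← gapRl_eq_zero (M := M) hρ' σx', outerRl_add_gapRl h,
      outerRl_add_gapRl h', hT]
  rw [ha, hl]
  exact h'.uncodedAttains_outerRa_sub_gapRa

theorem half_logb_gap_le {ρ σx k : ℝ} (h : M.Admissible ρ σx) (hk : 0 < k) (hP : M.P ≤ k ^ 2) :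
    1 / 2 * Real.logb 2 (1 + σx ^ 2 * (1 - ρ ^ 2) / k ^ 2) ≤ 1 / 2 := by
  have h1 := h.one_sub_sq_nonneg
  have h2 : σx ^ 2 * (1 - ρ ^ 2) / k ^ 2 ≤ 1 := by
    rw [div_le_one (by positivity)]
    nlinarith [h.2.2.2, mul_nonneg (sq_nonneg σx) (sq_nonneg ρ)]
  have h3 := Real.logb_le_logb_of_le one_lt_two (by positivity)
    (show 1 + σx ^ 2 * (1 - ρ ^ 2) / k ^ 2 ≤ 2 by linarith)
  rw [Real.logb_self_eq_one one_lt_two] at h3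
  linarith

theorem gapRa_le_half {ρ σx : ℝ} (h : M.Admissible ρ σx) (hP : M.P ≤ M.σn ^ 2) :
    M.gapRa ρ σx ≤ 1 / 2 :=
  half_logb_gap_le h M.σn_pos hP

theorem gapRl_le_half {ρ σx : ℝ} (h : M.Admissible ρ σx) (hP : M.P ≤ M.σnz ^ 2) :
    M.gapRl ρ σx ≤ 1 / 2 :=
  half_logb_gap_le h (M.σn_pos.trans_le M.σn_le_σnz) hP

/-! ### Corner points of the outer region -/

theorem outerRa_le {ρ σx : ℝ} (h : M.Admissible ρ σx) : M.outerRa ρ σx ≤ M.outerRa 1 √M.P := by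
  obtain ⟨h1, h2, h3, h4⟩ := h
  have hs := M.σs_pos
  have hn := M.σn_pos
  have hx : σx ≤ √M.P := Real.le_sqrt_of_sq_le h4
  have hsx : 0 ≤ M.σs * σx := by positivity
  have hlow : 0 ≤ M.σs ^ 2 + σx ^ 2 + 2 * ρ * M.σs * σx := by
    nlinarith [sq_nonneg (M.σs - σx)]
  have hle : M.σs ^ 2 + σx ^ 2 + 2 * ρ * M.σs * σx ≤
      M.σs ^ 2 + √M.P ^ 2 + 2 * 1 * M.σs * √M.P := by
    nlinarith [mul_le_mul_of_nonneg_left hx hs.le]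
  have := Real.logb_le_logb_of_le one_lt_two (by positivity) (add_le_add_right
    (div_le_div_of_nonneg_right hle (sq_nonneg M.σn)) 1)
  rw [outerRa, outerRa]
  linarith

theorem outerRl_ge (hint : M.σs * √M.P ≤ M.σnz ^ 2 + M.P) {ρ σx : ℝ} (h : M.Admissible ρ σx) :
    M.outerRl (-1) (min √M.P M.σs) ≤ M.outerRl ρ σx := by
  rcases le_total M.σs √M.P with hle | hle
  -- There is enough power to cancel the state completely, so the leakage is zero.
  · refine le_trans (le_of_eq ?_) (uncodedRate_nonneg h M.σnz)
    rw [min_eq_right hle, outerRl,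
      show M.σs ^ 2 + (-1) ^ 2 * M.σs ^ 2 + 2 * -1 * M.σs * M.σs = 0 by ring]
    simp
  · have h1 := h.one_sub_sq_nonneg
    obtain ⟨hl, hu, h3, h4⟩ := h
    have hk : 0 < M.σnz := M.σn_pos.trans_le M.σn_le_σnz
    have hx : σx ≤ √M.P := Real.le_sqrt_of_sq_le h4
    have hp := Real.sq_sqrt M.P_nonneg
    have hp0 := Real.sqrt_nonneg M.P
    rw [min_eq_left hle, outerRl, outerRl]
    set p := √M.P
    have hv : 0 ≤ ρ * σx + p := by nlinarith
    have key : (M.σs - p) ^ 2 / M.σnz ^ 2 ≤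
        (M.σs + ρ * σx) ^ 2 / (M.σnz ^ 2 + σx ^ 2 * (1 - ρ ^ 2)) := by
      rw [div_le_div_iff₀ (by positivity) (by positivity)]
      have hd : 0 ≤ M.σs - p := sub_nonneg.2 hle
      have e1 : 0 ≤ (M.σs - p) ^ 2 * (p ^ 2 - σx ^ 2) :=
        mul_nonneg (sq_nonneg _) (by linarith)
      have e2 : 0 ≤ (ρ * σx + p) * (M.σs - p) * (M.σnz ^ 2 + p ^ 2 - M.σs * p) :=
        mul_nonneg (mul_nonneg hv hd) (by linarith)
      have e3 : 0 ≤ (ρ * σx + p) ^ 2 * (M.σnz ^ 2 + (M.σs - p) ^ 2) := by positivity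
      -- With `v = ρ σx + p ≥ 0` and `d = σs - p ≥ 0`, the cross-multiplied difference is `d² (p² -
      -- σx²) + 2 v d (σnz² + p² - σs p) + v² (σnz² + d²)`. The hypothesis `hint` is exactly
      -- nonnegativity of the factor in the middle term.
      linear_combination e1 + 2 * e2 + e3
    have := Real.logb_le_logb_of_le one_lt_two (by positivity) (add_le_add_right key 1)
    have e1 : M.σs ^ 2 + (-1) ^ 2 * p ^ 2 + 2 * -1 * M.σs * p = (M.σs - p) ^ 2 := by ring
    have e2 : M.σs ^ 2 + ρ ^ 2 * σx ^ 2 + 2 * ρ * M.σs * σx = (M.σs + ρ * σx) ^ 2 := by ring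
    have e3 : M.σnz ^ 2 + p ^ 2 * (1 - (-1) ^ 2) = M.σnz ^ 2 := by ring
    rw [e1, e2, e3]
    linarith

end DegradedGaussianModel

end

theorem mainTheorem12 (M : DegradedGaussianModel) :
    -- each outer-bound point `(outerRa ρ σx, outerRl ρ σx)`
    (∀ ρ σx : ℝ, M.Admissible ρ σx →
      -- same `R_l`, and the gap in `R_a`
      M.UncodedAttains (M.outerRa ρ σx - M.gapRa ρ σx) (M.outerRl ρ σx) ∧
      (M.P ≤ M.σn ^ 2 → M.gapRa ρ σx ≤ 1 / 2) ∧
      -- same `R_a`, and the gap in `R_l`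
      M.UncodedAttains (M.outerRa ρ σx) (M.outerRl ρ σx + M.gapRl ρ σx) ∧
      (M.P ≤ M.σnz ^ 2 → M.gapRl ρ σx ≤ 1 / 2) ∧
      -- the gaps vanish at `ρ = ±1`
      (ρ = 1 ∨ ρ = -1 → M.gapRa ρ σx = 0 ∧ M.gapRl ρ σx = 0 ∧
        M.UncodedAttains (M.outerRa ρ σx) (M.outerRl ρ σx))) ∧
    -- hence the half-bit gap for every point of the outer-bound region
    (∀ Ra Rl : ℝ, (Ra, Rl) ∈ M.outerRegion →
      (M.P ≤ M.σn ^ 2 → M.UncodedAchieves (Ra - 1 / 2) Rl) ∧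
      (M.P ≤ M.σnz ^ 2 → M.UncodedAchieves Ra (Rl + 1 / 2))) ∧
    -- maximum amplification corresponds to `ρ = 1`
    IsGreatest (Prod.fst '' M.outerRegion) (M.outerRa 1 √M.P) ∧
    -- minimum leakage corresponds to `ρ = -1`, outside of the strong interference regime
    (M.σs * √M.P ≤ M.σnz ^ 2 + M.P →
      IsLeast (Prod.snd '' M.outerRegion) (M.outerRl (-1) (min √M.P M.σs))) := by
  refine ⟨fun ρ σx h => ⟨h.uncodedAttains_outerRa_sub_gapRa,
    DegradedGaussianModel.gapRa_le_half h, h.uncodedAttains_outerRl_add_gapRl,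
    DegradedGaussianModel.gapRl_le_half h, fun hρ => ?_⟩, ?_, ⟨?_, ?_⟩, fun hint => ⟨?_, ?_⟩⟩
  · have hρ2 : ρ ^ 2 = 1 := by rcases hρ with rfl | rfl <;> norm_num
    have ha := DegradedGaussianModel.gapRa_eq_zero (M := M) hρ2 σx
    refine ⟨ha, DegradedGaussianModel.gapRl_eq_zero hρ2 σx, ?_⟩
    have := h.uncodedAttains_outerRa_sub_gapRa
    rwa [ha, sub_zero] at this
  · rintro Ra Rl ⟨ρ, σx, h, ha, hl⟩
    dsimp only at ha hl
    refine ⟨fun hP => h.uncodedAttains_outerRa_sub_gapRa.uncodedAchieves ?_ hl,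
      fun hP => h.uncodedAttains_outerRl_add_gapRl.uncodedAchieves ha ?_⟩
    · linarith [DegradedGaussianModel.gapRa_le_half h hP]
    · linarith [DegradedGaussianModel.gapRl_le_half h hP]
  · exact ⟨(_, M.outerRl 1 √M.P), ⟨1, √M.P, ⟨by norm_num, le_rfl, Real.sqrt_nonneg _,
      (Real.sq_sqrt M.P_nonneg).le⟩, le_rfl, le_rfl⟩, rfl⟩
  · rintro _ ⟨q, ⟨ρ, σx, h, ha, -⟩, rfl⟩
    exact ha.trans (DegradedGaussianModel.outerRa_le h)
  · refine ⟨(M.outerRa (-1) (min √M.P M.σs), _), ⟨-1, min √M.P M.σs, ⟨le_rfl, by norm_num,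
      le_min (Real.sqrt_nonneg _) M.σs_pos.le, ?_⟩, le_rfl, le_rfl⟩, rfl⟩
    exact (pow_le_pow_left₀ (le_min (Real.sqrt_nonneg _) M.σs_pos.le) (min_le_left _ _) 2).trans
      (Real.sq_sqrt M.P_nonneg).le
  · rintro _ ⟨q, ⟨ρ, σx, h, -, hl⟩, rfl⟩
    exact (DegradedGaussianModel.outerRl_ge hint h).trans hl
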